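/- Let $d_A,d_B\ge 1$ and consider unitaries on $\mathbb{C}^{d_A}\otimes\mathbb{C}^{d_B}$ with computational bases $|j\rangle$ of the two factors. A unitary is controlled in the computational basis from the $A$ side if it has the form $\sum_{j=1}^{d_A}|j\rangle\langle j|\otimes U_j$ with unitaries $U_j$ on $\mathbb{C}^{d_B}$, and from the $B$ side if it has the form $\sum_{j=1}^{d_B}V_j\otimes|j\rangle\langle j|$ with unitaries $V_j$ on $\mathbb{C}^{d_A}$. A controlled unitary is a unitary of the form $(P\otimes Q)\,C\,(R\otimes S)$, where $P,Q,R,S$ are local unitaries and $C$ is controlled in the computational basis from the $A$ side or from the $B$ side. An $m$-sandwich form of $U$ is a decomposition $U=U_1U_2\cdots U_m$ in which $U_i$ is controlled in the computational basis from the $A$ side for odd $i$ and from the $B$ side for even $i$. Let $c(U)$ be the least $k\ge1$ such that $U$ is a product of $k$ controlled unitaries. (i) Every unitary $U$ on $\mathbb{C}^{d_A}\otimes\mathbb{C}^{d_B}$ has a $(2^{\lceil \log_2 d_A\rceil+1}-1)$-sandwich form. Hence, if $d_A\ge 2$, $$c(U)\le 2^{\lceil \log_2 d_A\rceil+1}-1\le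 4d_A-5,$$ and $c(U)\le 2d_A-1$ whenever $d_A$ is a power of $2$. (ii) Fix $d_B$. If for every odd $d_A\ge3$ every unitary on $\mathbb{C}^{d_A}\otimes\mathbb{C}^{d_B}$ has a $(2d_A-1)$-sandwich form, then for every even $d_A\ge2$ every unitary on $\mathbb{C}^{d_A}\otimes\mathbb{C}^{d_B}$ has a $(2d_A-1)$-sandwich form. -/

import Mathlib

open scoped Kronecker

section

variable {a b : Type*} [Fintype a] [DecidableEq a] [Fintype b] [DecidableEq b]

/-- `U = ∑ j, |j⟩⟨j| ⊗ V j` with every `V j` unitary: `U` is controlled from the `A` side in the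
computational basis of `A`. The computational basis of the bipartite space is indexed
by `a × b`. -/
def ControlledInBasisA (U : Matrix (a × b) (a × b) ℂ) : Prop :=
  ∃ V : a → Matrix b b ℂ, (∀ j, V j ∈ Matrix.unitaryGroup b ℂ) ∧
    U = ∑ j : a, Matrix.single j j (1 : ℂ) ⊗ₖ V j

/-- `U = ∑ j, V j ⊗ |j⟩⟨j|` with every `V j` unitary: `U` is controlled from the `B` side in the
computational basis of `B`. -/
def ControlledInBasisB (U : Matrix (a × b) (a × b) ℂ) : Prop :=
  ∃ V : b → Matrix a a ℂ, (∀ j, V j ∈ Matrix.unitaryGroup a ℂ) ∧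
    U = ∑ j : b, V j ⊗ₖ Matrix.single j j (1 : ℂ)

/-- `U` equals `C` up to local unitaries on the left and on the right. -/
def LocallyEquivalent (U C : Matrix (a × b) (a × b) ℂ) : Prop :=
  ∃ P ∈ Matrix.unitaryGroup a ℂ, ∃ Q ∈ Matrix.unitaryGroup b ℂ,
  ∃ R ∈ Matrix.unitaryGroup a ℂ, ∃ S ∈ Matrix.unitaryGroup b ℂ,
    U = (P ⊗ₖ Q) * C * (R ⊗ₖ S)

/-- A controlled unitary gate: locally equivalent to a unitary that is controlled in the
computational basis from the `A` side or from the `B` side. -/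
def IsControlledUnitary (U : Matrix (a × b) (a × b) ℂ) : Prop :=
  ∃ C : Matrix (a × b) (a × b) ℂ,
    (ControlledInBasisA C ∨ ControlledInBasisB C) ∧ LocallyEquivalent U C

/-- `U = U₁ U₂ ⋯ Uₘ` where `Uᵢ` is controlled in the computational basis, from `A` for odd `i`
and from `B` for even `i`. The factor `Uᵢ` is `G (i - 1)`, so the parity is that of `i + 1`
for the index `i : Fin m`. -/
def HasSandwichForm (m : ℕ) (U : Matrix (a × b) (a × b) ℂ) : Prop :=
  ∃ G : Fin m → Matrix (a × b) (a × b) ℂ,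
    (∀ i : Fin m, (Odd ((i : ℕ) + 1) → ControlledInBasisA (G i)) ∧
      (Even ((i : ℕ) + 1) → ControlledInBasisB (G i))) ∧
    U = (List.ofFn G).prod

/-- `U = U₁ U₂ ⋯ Uₖ` for controlled unitaries `Uᵢ`. -/
def IsProductOfControlled (k : ℕ) (U : Matrix (a × b) (a × b) ℂ) : Prop :=
  ∃ G : Fin k → Matrix (a × b) (a × b) ℂ,
    (∀ i, IsControlledUnitary (G i)) ∧ U = (List.ofFn G).prod

/-- The bipartite depth `c(U)`: the least `k ≥ 1` such that `U` is a product of `k` controlled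
unitaries. It takes values in `ℕ∞`, with `c(U) = ⊤` if there is no such `k`. -/
noncomputable def bipartiteDepth (U : Matrix (a × b) (a × b) ℂ) : ℕ∞ :=
  ⨅ k ∈ {k : ℕ | 1 ≤ k ∧ IsProductOfControlled k U}, (k : ℕ∞)

end

/-! Split the `A` space as a direct sum of dimensions p ≤ q. The cosine-sine decomposition writes U
= (A₀ ⊕ A₁) M (B₀ ⊕ B₁), where M only mixes each basis vector of the smaller summand with a partner
in the larger one. The partner is chosen with the same `B` label, so M is controlled from the `B`
side (`cosine_sine_decomposition`, `hasSandwichForm_sum`). The outer factors act on smaller systems;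
if all blocks have m-sandwich forms, these add factor by factor. For odd m they begin and end on the
`A` side, so U gets length 2m + 1. Dimension at most 1 needs one factor, and n halvings give 2^(n+1)
- 1, whence (i). For (ii), m = 2p - 1 yields 2m + 1 = 2(2p) - 1, so an even dimension inherits the
bound from its half. -/

/-! ### Controlled unitaries as unitaries with a zero pattern -/

section ControlledEntries

variable {a b : Type*} [Fintype a] [DecidableEq a] [Fintype b] [DecidableEq b]

theorem controlledInBasisA_of_unitary {U : Matrix (a × b) (a × b) ℂ}
    (hU : U ∈ Matrix.unitaryGroup (a × b) ℂ)
    (h : ∀ x y : a × b, x.1 ≠ y.1 → U x y = 0) : ControlledInBasisA U := by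
  refine ⟨fun j => U.submatrix (fun k => (j, k)) (fun k => (j, k)), fun j => ?_, ?_⟩
  · rw [Matrix.mem_unitaryGroup_iff] at hU ⊢
    ext k l
    have h1 := congrFun (congrFun hU (j, k)) (j, l)
    rw [Matrix.mul_apply, Fintype.sum_prod_type, Finset.sum_eq_single j] at h1
    · simpa [Matrix.mul_apply, Matrix.one_apply, Matrix.star_apply] using h1
    · intro i _ hi
      exact Finset.sum_eq_zero fun x _ => by rw [h (j, k) (i, x) (Ne.symm hi), zero_mul]
    · simp
  · ext ⟨j, k⟩ ⟨j', k'⟩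
    rw [Matrix.sum_apply]
    by_cases hj : j = j'
    · subst hj
      simp [Matrix.single_apply]
    · rw [h _ _ hj, Finset.sum_eq_zero]
      intro i _
      by_cases hi : i = j
      · subst hi; simp [hj]
      · simp [hi]

theorem ControlledInBasisA.apply_eq_zero {U : Matrix (a × b) (a × b) ℂ}
    (hU : ControlledInBasisA U) {x y : a × b} (h : x.1 ≠ y.1) : U x y = 0 := by
  obtain ⟨V, -, rfl⟩ := hU
  rw [Matrix.sum_apply]
  refine Finset.sum_eq_zero fun i _ => ?_
  rw [Matrix.kroneckerMap_apply, Matrix.single_apply, if_neg, zero_mul]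
  rintro ⟨h1, h2⟩
  exact h (h1.symm.trans h2)

theorem ControlledInBasisA.mem_unitaryGroup {U : Matrix (a × b) (a × b) ℂ}
    (hU : ControlledInBasisA U) : U ∈ Matrix.unitaryGroup (a × b) ℂ := by
  obtain ⟨V, hV, rfl⟩ := hU
  rw [Matrix.mem_unitaryGroup_iff, star_sum, Finset.sum_mul]
  have h : ∀ i : a, (Matrix.single i i (1 : ℂ) ⊗ₖ V i) *
      ∑ j : a, star (Matrix.single j j (1 : ℂ) ⊗ₖ V j) =
        Matrix.single i i (1 : ℂ) ⊗ₖ (1 : Matrix b b ℂ) := by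
    intro i
    rw [Finset.mul_sum, Finset.sum_eq_single i]
    · have := Matrix.mem_unitaryGroup_iff.1 (hV i)
      rw [Matrix.star_eq_conjTranspose] at this
      simp [Matrix.star_eq_conjTranspose, Matrix.conjTranspose_kronecker,
        ← Matrix.mul_kronecker_mul, this]
    · intro j _ hj
      simp [Matrix.star_eq_conjTranspose, Matrix.conjTranspose_kronecker,
        ← Matrix.mul_kronecker_mul, hj.symm]
    · simp
  rw [Finset.sum_congr rfl fun i _ => h i]
  ext ⟨j, k⟩ ⟨j', k'⟩
  rw [Matrix.sum_apply, Finset.sum_eq_single j]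
  · by_cases hj : j = j'
    · simp [hj, Matrix.one_apply]
    · simp [hj]
  · intro i _ hi
    simp [hi]
  · simp

/-- Trades the existential for unitarity plus a zero pattern, both of which pass easily through
relabellings and direct sums. -/
theorem controlledInBasisA_iff {U : Matrix (a × b) (a × b) ℂ} :
    ControlledInBasisA U ↔ U ∈ Matrix.unitaryGroup (a × b) ℂ ∧
      ∀ x y : a × b, x.1 ≠ y.1 → U x y = 0 :=
  ⟨fun h => ⟨h.mem_unitaryGroup, fun _ _ => h.apply_eq_zero⟩,
    fun h => controlledInBasisA_of_unitary h.1 h.2⟩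

theorem submatrix_mem_unitaryGroup {m n : Type*} [Fintype m] [DecidableEq m] [Fintype n]
    [DecidableEq n] {U : Matrix n n ℂ} (hU : U ∈ Matrix.unitaryGroup n ℂ) (e : m ≃ n) :
    U.submatrix e e ∈ Matrix.unitaryGroup m ℂ := by
  rw [Matrix.mem_unitaryGroup_iff] at hU ⊢
  rw [Matrix.star_eq_conjTranspose, Matrix.conjTranspose_submatrix, Matrix.submatrix_mul_equiv,
    ← Matrix.star_eq_conjTranspose, hU, Matrix.submatrix_one_equiv]

theorem controlledInBasisB_iff_swap {U : Matrix (a × b) (a × b) ℂ} :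
    ControlledInBasisB U ↔ ControlledInBasisA (U.submatrix (Prod.swap : b × a → _) Prod.swap) := by
  have h : ∀ V : b → Matrix a a ℂ,
      (∑ j : b, V j ⊗ₖ Matrix.single j j (1 : ℂ)).submatrix (Prod.swap : b × a → _) Prod.swap =
        ∑ j : b, Matrix.single j j (1 : ℂ) ⊗ₖ V j := by
    intro V
    ext x y
    simp [Matrix.sum_apply, mul_comm]
  constructor
  · rintro ⟨V, hV, rfl⟩
    exact ⟨V, hV, h V⟩
  · rintro ⟨V, hV, hU⟩
    refine ⟨V, hV, ?_⟩
    rw [← h] at hU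
    ext x y
    exact congrFun (congrFun hU x.swap) y.swap

theorem controlledInBasisB_iff {U : Matrix (a × b) (a × b) ℂ} :
    ControlledInBasisB U ↔ U ∈ Matrix.unitaryGroup (a × b) ℂ ∧
      ∀ x y : a × b, x.2 ≠ y.2 → U x y = 0 := by
  rw [controlledInBasisB_iff_swap, controlledInBasisA_iff]
  refine and_congr ⟨fun h => ?_, fun h => ?_⟩ ⟨fun h x y => h x.swap y.swap, fun h x y => h x.swap y.swap⟩
  · exact submatrix_mem_unitaryGroup h (Equiv.prodComm a b)
  · exact submatrix_mem_unitaryGroup h (Equiv.prodComm b a)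

end ControlledEntries

/-! ### Cosine-sine decomposition with unequal blocks -/

section CosineSine

open Matrix
open scoped ComplexOrder

variable {m n : Type*} [Fintype m] [DecidableEq m] [Fintype n] [DecidableEq n]

/-- A matrix with pairwise orthogonal rows has its rows proportional to rows of a unitary matrix. -/
theorem exists_unitary_rows (f : m ↪ n) (Y : Matrix m n ℂ) (r : m → ℝ)
    (hY : Y * Yᴴ = diagonal fun i => ((r i ^ 2 : ℝ) : ℂ)) :
    ∃ B ∈ unitaryGroup n ℂ, ∀ i k, Y i k = r i * B (f i) k := by
  have hY' : ∀ i j, ∑ k, Y i k * star (Y j k) = if i = j then ((r i ^ 2 : ℝ) : ℂ) else 0 := by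
    intro i j
    have := congrFun (congrFun hY i) j
    simpa [Matrix.mul_apply, Matrix.diagonal_apply] using this
  let v : n → EuclideanSpace ℂ n := fun t =>
    if h : ∃ i, f i = t then WithLp.toLp 2 fun k => (r h.choose : ℂ)⁻¹ * Y h.choose k else 0
  have hv : ∀ i k, v (f i) k = (r i : ℂ)⁻¹ * Y i k := by
    intro i k
    have h : ∃ j, f j = f i := ⟨i, rfl⟩
    have h2 : h.choose = i := f.injective h.choose_spec
    simp only [v, dif_pos h, h2]
  -- Only nonzero rows can be normalised; they are orthonormal and extend to a full orthonormal
  -- basis.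
  let s : Set n := f '' {i | r i ≠ 0}
  have hs : Orthonormal ℂ (s.domRestrict v) := by
    rw [orthonormal_iff_ite]
    intro p q
    obtain ⟨i, hi, hpi⟩ := p.2
    obtain ⟨j, hj, hqj⟩ := q.2
    have hpq : p = q ↔ i = j := by rw [Subtype.ext_iff, ← hpi, ← hqj, f.injective.eq_iff]
    have hi' : (r i : ℂ) ≠ 0 := by exact_mod_cast hi
    have h1 : inner ℂ (v (f i)) (v (f j)) = (r j : ℂ)⁻¹ * (r i : ℂ)⁻¹ *
        ∑ k, Y j k * star (Y i k) := by
      rw [PiLp.inner_apply, Finset.mul_sum]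
      refine Finset.sum_congr rfl fun k _ => ?_
      rw [hv, hv]
      simp
      ring
    rw [Set.domRestrict_apply, Set.domRestrict_apply, ← hpi, ← hqj, h1, hY']
    simp only [hpq]
    by_cases hij : i = j
    · subst hij
      simp
      field_simp
    · simp [hij, Ne.symm hij]
  obtain ⟨B, hB⟩ := hs.exists_orthonormalBasis_extension_of_card_eq (by simp)
  refine ⟨Matrix.of fun t k => B t k, ?_, fun i k => ?_⟩
  · rw [mem_unitaryGroup_iff]
    ext t u
    have := orthonormal_iff_ite.1 B.orthonormal u t
    rw [PiLp.inner_apply] at this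
    simp only [Matrix.mul_apply, Matrix.star_apply, Matrix.of_apply, Matrix.one_apply, eq_comm (a := t)]
    rw [← this]
    refine Finset.sum_congr rfl fun k _ => ?_
    simp
  -- If `r i = 0`, the diagonal entry of `hY` is the squared norm of row `i`, so that row vanishes.
  · by_cases hi : r i = 0
    · have h1 := hY' i i
      simp only [hi, if_true] at h1
      have h2 : ∑ k, ‖Y i k‖ ^ 2 = 0 := by
        have : ((∑ k, ‖Y i k‖ ^ 2 : ℝ) : ℂ) = 0 := by
          rw [← (by simpa using h1 : ∑ k, Y i k * star (Y i k) = 0)]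
          push_cast
          refine Finset.sum_congr rfl fun k _ => ?_
          exact (Complex.mul_conj' _).symm
        exact_mod_cast this
      have h3 := (Finset.sum_eq_zero_iff_of_nonneg (fun k _ => by positivity)).1 h2 k (Finset.mem_univ k)
      simp [hi] at h3 ⊢
      exact h3
    · have hi' : (r i : ℂ) ≠ 0 := by exact_mod_cast hi
      rw [Matrix.of_apply, hB (f i) ⟨i, hi, rfl⟩, hv, mul_inv_cancel_left₀ hi']

theorem fromBlocks_diagonal_mem_unitaryGroup {A : Matrix m m ℂ} {B : Matrix n n ℂ}
    (hA : A ∈ unitaryGroup m ℂ) (hB : B ∈ unitaryGroup n ℂ) :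
    fromBlocks A 0 0 B ∈ unitaryGroup (m ⊕ n) ℂ := by
  rw [mem_unitaryGroup_iff, star_eq_conjTranspose] at *
  simp [fromBlocks_conjTranspose, fromBlocks_multiply, hA, hB]

/-- A unitary that rotates each basis vector `i` of `m` with the basis vector `f i` of `n`. -/
theorem exists_rotation (f : m ↪ n) (c s : m → ℝ) (h : ∀ i, c i ^ 2 + s i ^ 2 = 1) :
    ∃ M ∈ unitaryGroup (m ⊕ n) ℂ,
      (∀ i x, M (Sum.inl i) x = Sum.elim (fun j => if i = j then (c i : ℂ) else 0)
        (fun t => if f i = t then (s i : ℂ) else 0) x) ∧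
      ∀ x y, Sum.elim f id x ≠ Sum.elim f id y → M x y = 0 := by
  let P : Matrix m n ℂ := of fun i t => if f i = t then 1 else 0
  let C : Matrix m m ℂ := diagonal fun i => (c i : ℂ)
  let S : Matrix m m ℂ := diagonal fun i => (s i : ℂ)
  have hP : P * Pᴴ = 1 := by
    ext i j
    simp [P, Matrix.mul_apply, Matrix.one_apply, f.injective.eq_iff, eq_comm]
  have hPX : ∀ X : Matrix m n ℂ, P * (Pᴴ * X) = X := fun X => by
    rw [← Matrix.mul_assoc, hP, Matrix.one_mul]
  have hC : Cᴴ = C := by simp [C, diagonal_conjTranspose]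
  have hS : Sᴴ = S := by simp [S, diagonal_conjTranspose]
  have hCS : C * S = S * C := by simp [C, S, mul_comm]
  have hCS1 : C * C + S * S = 1 := by
    simp only [C, S, diagonal_mul_diagonal, diagonal_add]
    rw [← diagonal_one]
    congr 1
    ext i
    have := h i
    rw [← sq, ← sq]
    exact_mod_cast this
  -- The last block acts as the cosines on the vectors `f i` and as the identity on the unpaired
  -- ones.
  refine ⟨fromBlocks C (S * P) (-(Pᴴ * S)) (1 - Pᴴ * P + Pᴴ * C * P), ?_, ?_, ?_⟩
  · have h11 : C * C + S * P * (Pᴴ * S) = 1 := by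
      rw [Matrix.mul_assoc, ← Matrix.mul_assoc P, hP, Matrix.one_mul, hCS1]
    have h12 : C * -(S * P) + S * P * (1 - Pᴴ * P + Pᴴ * C * P) = 0 := by
      simp only [Matrix.mul_add, Matrix.mul_sub, Matrix.mul_assoc, hPX, Matrix.mul_one, Matrix.mul_neg]
      rw [← Matrix.mul_assoc C, hCS, Matrix.mul_assoc]
      abel
    have h22 : Pᴴ * S * (S * P) + (1 - Pᴴ * P + Pᴴ * C * P) * (1 - Pᴴ * P + Pᴴ * C * P) = 1 := by
      have hCS2 : C * (C * P) = P - S * (S * P) := by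
        rw [← Matrix.mul_assoc, ← Matrix.mul_assoc, eq_sub_iff_add_eq, ← Matrix.add_mul, hCS1,
          Matrix.one_mul]
      simp only [Matrix.mul_add, Matrix.mul_sub, Matrix.add_mul, Matrix.sub_mul, Matrix.mul_assoc,
        hPX, Matrix.mul_one, Matrix.one_mul, hCS2]
      abel
    have h4 : (1 - Pᴴ * P + Pᴴ * C * P)ᴴ = 1 - Pᴴ * P + Pᴴ * C * P := by
      simp [conjTranspose_mul, hC, Matrix.mul_assoc]
    have h21 : -(Pᴴ * S) * C + (1 - Pᴴ * P + Pᴴ * C * P) * (Pᴴ * S) = 0 := by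
      have := congrArg conjTranspose h12
      simpa [conjTranspose_mul, h4, hC, hS, Matrix.mul_assoc] using this
    rw [mem_unitaryGroup_iff, star_eq_conjTranspose, fromBlocks_conjTranspose, fromBlocks_multiply,
      ← fromBlocks_one, conjTranspose_neg, conjTranspose_mul, conjTranspose_mul, hC, hS, h4,
      conjTranspose_conjTranspose, h11, h12, h21, Matrix.neg_mul, Matrix.mul_neg,
      neg_neg, h22]
  · rintro i (j | t)
    · simp [C, diagonal_apply]
    · simp [S, P]
  · rintro (i | t) (j | u) hxy
    · have : i ≠ j := fun h => hxy (by simp [h])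
      simp [C, this]
    · have : f i ≠ u := hxy
      simp [S, P, this]
    · have : f j ≠ t := Ne.symm hxy
      simp [S, P, this]
    · have htu : t ≠ u := hxy
      have h1 : ∀ D : m → ℂ, (Pᴴ * diagonal D * P) t u = 0 := by
        intro D
        rw [Matrix.mul_apply]
        refine Finset.sum_eq_zero fun i _ => ?_
        rw [mul_diagonal]
        by_cases hi : f i = t
        · simp [P, hi, htu]
        · simp [P, hi]
      have h2 := h1 1
      rw [Pi.one_def, diagonal_one, Matrix.mul_one] at h2
      simp [C, h1, h2, htu]

/-- The cosine-sine decomposition of a unitary on `m ⊕ n`, where `m` embeds into `n`. -/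
theorem cosine_sine_decomposition (f : m ↪ n) {U : Matrix (m ⊕ n) (m ⊕ n) ℂ}
    (hU : U ∈ unitaryGroup (m ⊕ n) ℂ) :
    ∃ A₀ ∈ unitaryGroup m ℂ, ∃ A₁ ∈ unitaryGroup n ℂ, ∃ B₀ ∈ unitaryGroup m ℂ,
    ∃ B₁ ∈ unitaryGroup n ℂ, ∃ M ∈ unitaryGroup (m ⊕ n) ℂ,
      (∀ x y, Sum.elim f id x ≠ Sum.elim f id y → M x y = 0) ∧
      U = fromBlocks A₀ 0 0 A₁ * M * fromBlocks B₀ 0 0 B₁ := by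
  have hUU := hU
  rw [mem_unitaryGroup_iff, star_eq_conjTranspose, ← fromBlocks_toBlocks U,
    fromBlocks_conjTranspose, fromBlocks_multiply, ← fromBlocks_one, fromBlocks_inj] at hUU
  set X := U.toBlocks₁₁
  set Z := U.toBlocks₁₂
  have hXZ : X * Xᴴ + Z * Zᴴ = 1 := hUU.1
  have hH : (X * Xᴴ).PosSemidef := posSemidef_self_mul_conjTranspose X
  have hH' : (Z * Zᴴ).PosSemidef := posSemidef_self_mul_conjTranspose Z
  obtain ⟨A₀, hA₀, d, hd⟩ : ∃ A₀ ∈ unitaryGroup m ℂ, ∃ d : m → ℝ,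
      A₀ᴴ * (X * Xᴴ) * A₀ = diagonal fun i => (d i : ℂ) := by
    refine ⟨hH.1.eigenvectorUnitary, hH.1.eigenvectorUnitary.2, hH.1.eigenvalues, ?_⟩
    have h := hH.1.conjStarAlgAut_star_eigenvectorUnitary
    rw [Unitary.conjStarAlgAut_star_apply] at h
    exact h
  have hAA : A₀ᴴ * A₀ = 1 := mem_unitaryGroup_iff'.1 hA₀
  have hAA' : A₀ * A₀ᴴ = 1 := mem_unitaryGroup_iff.1 hA₀
  -- As XXᴴ + ZZᴴ = 1, one unitary diagonalises both, and positivity puts `d i` in [0, 1]: cosines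
  -- √d, sines √(1 - d).
  have hd' : A₀ᴴ * (Z * Zᴴ) * A₀ = diagonal fun i => ((1 - d i : ℝ) : ℂ) := by
    rw [eq_sub_of_add_eq' hXZ, Matrix.mul_sub, Matrix.sub_mul, Matrix.mul_one, hAA, hd,
      ← diagonal_one, diagonal_sub]
    simp
  have hd0 : ∀ i, 0 ≤ d i := fun i => by
    have := (hH.conjTranspose_mul_mul_same A₀).diag_nonneg (i := i)
    rw [hd, diagonal_apply_eq] at this
    exact_mod_cast this
  have hd1 : ∀ i, 0 ≤ 1 - d i := fun i => by
    have := (hH'.conjTranspose_mul_mul_same A₀).diag_nonneg (i := i)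
    rw [hd', diagonal_apply_eq] at this
    exact_mod_cast this
  obtain ⟨B₀, hB₀, hB₀'⟩ := exists_unitary_rows (Function.Embedding.refl m) (A₀ᴴ * X)
    (fun i => √(d i)) (by
      simp only [Real.sq_sqrt (hd0 _)]
      rw [← hd, conjTranspose_mul, conjTranspose_conjTranspose]
      simp only [Matrix.mul_assoc])
  obtain ⟨B₁, hB₁, hB₁'⟩ := exists_unitary_rows f (A₀ᴴ * Z)
    (fun i => √(1 - d i)) (by
      simp only [Real.sq_sqrt (hd1 _)]
      rw [← hd', conjTranspose_mul, conjTranspose_conjTranspose]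
      simp only [Matrix.mul_assoc])
  obtain ⟨M, hM, hMrow, hMloc⟩ := exists_rotation f (fun i => √(d i)) (fun i => √(1 - d i))
    (fun i => by rw [Real.sq_sqrt (hd0 i), Real.sq_sqrt (hd1 i)]; ring)
  set B := fromBlocks B₀ 0 0 B₁
  have hB : B ∈ unitaryGroup (m ⊕ n) ℂ := fromBlocks_diagonal_mem_unitaryGroup hB₀ hB₁
  have hMB : M * B ∈ unitaryGroup (m ⊕ n) ℂ := mul_mem hM hB
  -- `W` is the left factor forced by the others. Its top rows turn out to be (A₀, 0), and unitarity
  -- then makes it block diagonal.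
  set W := U * (M * B)ᴴ
  have hW : W ∈ unitaryGroup (m ⊕ n) ℂ := mul_mem hU (Unitary.star_mem hMB)
  have hUW : U = W * (M * B) := by
    have : (M * B)ᴴ * (M * B) = 1 := mem_unitaryGroup_iff'.1 hMB
    rw [Matrix.mul_assoc, this, Matrix.mul_one]
  have hrow : ∀ i x, U (Sum.inl i) x = ∑ j, A₀ i j * (M * B) (Sum.inl j) x := by
    have h1 : ∀ j x, (M * B) (Sum.inl j) x =
        Sum.elim (fun k => (A₀ᴴ * X) j k) (fun k => (A₀ᴴ * Z) j k) x := by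
      rintro j (k | k)
      · simp [Matrix.mul_apply, hMrow, B, hB₀']
      · simp [Matrix.mul_apply, hMrow, B, hB₁']
    rintro i (k | k)
    · simp only [h1, Sum.elim_inl, ← Matrix.mul_apply]
      rw [← Matrix.mul_assoc, hAA', Matrix.one_mul]
      rfl
    · simp only [h1, Sum.elim_inr, ← Matrix.mul_apply]
      rw [← Matrix.mul_assoc, hAA', Matrix.one_mul]
      rfl
  have hrowW : ∀ i x, W (Sum.inl i) x = fromBlocks A₀ 0 0 (1 : Matrix n n ℂ) (Sum.inl i) x := by
    have h1 : (M * B) * (M * B)ᴴ = 1 := mem_unitaryGroup_iff.1 hMB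
    intro i x
    have h2 : W (Sum.inl i) x = ∑ j, A₀ i j * ((M * B) * (M * B)ᴴ) (Sum.inl j) x := by
      change (U * (M * B)ᴴ) _ _ = _
      rw [Matrix.mul_apply]
      simp only [hrow, Finset.sum_mul]
      rw [Finset.sum_comm]
      refine Finset.sum_congr rfl fun j _ => ?_
      rw [Matrix.mul_apply (M := M * B), Finset.mul_sum]
      simp only [mul_assoc]
    rw [h2, h1]
    rcases x with x | x
    · simp [Matrix.one_apply]
    · simp
  have hW11 : W.toBlocks₁₁ = A₀ := by ext i j; exact hrowW i (Sum.inl j)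
  have hW12 : W.toBlocks₁₂ = 0 := by ext i j; exact hrowW i (Sum.inr j)
  have hWW := hW
  rw [mem_unitaryGroup_iff, star_eq_conjTranspose, ← fromBlocks_toBlocks W, hW11, hW12,
    fromBlocks_conjTranspose, fromBlocks_multiply, ← fromBlocks_one, fromBlocks_inj] at hWW
  have hW21 : W.toBlocks₂₁ = 0 := by
    have h1 : W.toBlocks₂₁ * A₀ᴴ = 0 := by simpa using hWW.2.2.1
    rw [← Matrix.mul_one W.toBlocks₂₁, ← hAA, ← Matrix.mul_assoc, h1, Matrix.zero_mul]
  have hW22 : W.toBlocks₂₂ ∈ unitaryGroup n ℂ := by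
    have := hWW.2.2.2
    rw [hW21] at this
    rw [mem_unitaryGroup_iff, star_eq_conjTranspose]
    simpa using this
  refine ⟨A₀, hA₀, W.toBlocks₂₂, hW22, B₀, hB₀, B₁, hB₁, M, hM, hMloc, ?_⟩
  conv_lhs => rw [hUW, ← fromBlocks_toBlocks W, hW11, hW12, hW21]
  rw [Matrix.mul_assoc]

end CosineSine

/-! ### Direct sums along the `A` factor -/

section DirectSum

open Matrix

variable {a a' b : Type*}

/-- The direct sum of operators on two bipartite spaces, along the `A` factor. -/
def directSumA (X : Matrix (a × b) (a × b) ℂ) (Y : Matrix (a' × b) (a' × b) ℂ) :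
    Matrix ((a ⊕ a') × b) ((a ⊕ a') × b) ℂ :=
  (fromBlocks X 0 0 Y).submatrix (Equiv.sumProdDistrib a a' b) (Equiv.sumProdDistrib a a' b)

theorem directSumA_one [DecidableEq a] [DecidableEq a'] [DecidableEq b] :
    directSumA (1 : Matrix (a × b) (a × b) ℂ) (1 : Matrix (a' × b) (a' × b) ℂ) = 1 := by
  rw [directSumA, fromBlocks_one, submatrix_one_equiv]

theorem directSumA_mul [Fintype a] [Fintype a'] [Fintype b]
    (X X' : Matrix (a × b) (a × b) ℂ) (Y Y' : Matrix (a' × b) (a' × b) ℂ) :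
    directSumA (X * X') (Y * Y') = directSumA X Y * directSumA X' Y' := by
  rw [directSumA, directSumA, directSumA, submatrix_mul_equiv, fromBlocks_multiply]
  simp

end DirectSum

/-! ### Sandwich forms and the recursion on the dimension -/

section Sandwich

open Matrix

variable {a a' b : Type*} [Fintype a] [DecidableEq a] [Fintype a'] [DecidableEq a']
  [Fintype b] [DecidableEq b]

theorem controlledInBasisA_one : ControlledInBasisA (1 : Matrix (a × b) (a × b) ℂ) :=
  controlledInBasisA_iff.2 ⟨one_mem _, fun x y h => one_apply_ne fun h' => h (by rw [h'])⟩

theorem controlledInBasisB_one : ControlledInBasisB (1 : Matrix (a × b) (a × b) ℂ) :=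
  controlledInBasisB_iff.2 ⟨one_mem _, fun x y h => one_apply_ne fun h' => h (by rw [h'])⟩

/-- A sandwich form of length `m` given by an infinite sequence of alternating controlled
unitaries, of which only the first `m` are used. -/
theorem hasSandwichForm_iff {m : ℕ} {U : Matrix (a × b) (a × b) ℂ} :
    HasSandwichForm m U ↔ ∃ G : ℕ → Matrix (a × b) (a × b) ℂ,
      (∀ i, (Even i → ControlledInBasisA (G i)) ∧ (Odd i → ControlledInBasisB (G i))) ∧
      U = ((List.range m).map G).prod := by
  constructor
  · rintro ⟨G, hG, rfl⟩
    -- The padding by 1 is controlled from both sides, so parity is irrelevant there.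
    refine ⟨fun i => if h : i < m then G ⟨i, h⟩ else 1, fun i => ?_, ?_⟩
    · by_cases h : i < m
      · simp only [h, dif_pos]
        exact ⟨fun hi => (hG ⟨i, h⟩).1 hi.add_one, fun hi => (hG ⟨i, h⟩).2 hi.add_one⟩
      · simp only [h, dif_neg, not_false_eq_true]
        exact ⟨fun _ => controlledInBasisA_one, fun _ => controlledInBasisB_one⟩
    · rw [List.ofFn_eq_map, ← List.map_coe_finRange_eq_range, List.map_map]
      congr 2
      ext i
      simp
  · rintro ⟨G, hG, rfl⟩
    refine ⟨fun i => G i, fun i => ⟨fun hi => (hG i).1 ?_, fun hi => (hG i).2 ?_⟩, ?_⟩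
    · have := hi.add_one
      grind
    · have := hi.add_one
      grind
    · rw [List.ofFn_eq_map, ← List.map_coe_finRange_eq_range, List.map_map]
      rfl

theorem HasSandwichForm.mul_mul {m k : ℕ} (hm : Odd m) {U M V : Matrix (a × b) (a × b) ℂ}
    (hU : HasSandwichForm m U) (hM : ControlledInBasisB M) (hV : HasSandwichForm k V) :
    HasSandwichForm (m + 1 + k) (U * M * V) := by
  obtain ⟨G, hG, rfl⟩ := hasSandwichForm_iff.1 hU
  obtain ⟨H, hH, rfl⟩ := hasSandwichForm_iff.1 hV
  refine hasSandwichForm_iff.2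
    ⟨fun i => if i < m then G i else if i = m then M else H (i - (m + 1)), fun i => ?_, ?_⟩
  · rcases lt_trichotomy i m with h | rfl | h
    · simpa [h] using hG i
    · simpa [hM] using fun h => absurd hm (Nat.not_odd_iff_even.2 h)
    · have h1 : ¬ i < m := by omega
      have h2 : i ≠ m := by omega
      obtain ⟨j, rfl⟩ := Nat.exists_eq_add_of_lt h
      have h3 : m + j + 1 - (m + 1) = j := by omega
      simp only [h1, h2, if_false, h3]
      exact ⟨fun h => (hH j).1 (by grind), fun h => (hH j).2 (by grind)⟩
  · rw [List.range_add, List.range_succ, List.map_append, List.map_append, List.prod_append,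
      List.prod_append, List.map_map]
    congr 2
    · congr 1
      refine List.map_congr_left fun i hi => ?_
      simp [List.mem_range.1 hi]
    · simp
    · refine List.map_congr_left fun i _ => ?_
      have h1 : ¬ m + 1 + i < m := by omega
      have h2 : m + 1 + i ≠ m := by omega
      simp [h1, h2]

/-- Relabelling the basis of the `A` factor. -/
theorem HasSandwichForm.reindex {m : ℕ} (e : a' ≃ a) {U : Matrix (a × b) (a × b) ℂ}
    (h : HasSandwichForm m U) :
    HasSandwichForm m (U.submatrix (e.prodCongr (Equiv.refl b)) (e.prodCongr (Equiv.refl b))) := by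
  obtain ⟨G, hG, rfl⟩ := hasSandwichForm_iff.1 h
  let φ := reindexAlgEquiv ℂ ℂ (e.prodCongr (Equiv.refl b)).symm
  refine hasSandwichForm_iff.2 ⟨fun i => φ (G i), fun i => ⟨fun hi => ?_, fun hi => ?_⟩, ?_⟩
  · obtain ⟨h1, h2⟩ := controlledInBasisA_iff.1 ((hG i).1 hi)
    exact controlledInBasisA_iff.2 ⟨submatrix_mem_unitaryGroup h1 _,
      fun x y hxy => h2 _ _ (by simpa using hxy)⟩
  · obtain ⟨h1, h2⟩ := controlledInBasisB_iff.1 ((hG i).2 hi)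
    exact controlledInBasisB_iff.2 ⟨submatrix_mem_unitaryGroup h1 _,
      fun x y hxy => h2 _ _ (by simpa using hxy)⟩
  · refine (map_list_prod φ _).trans ?_
    rw [List.map_map]
    rfl

theorem directSumA_mem_unitaryGroup {X : Matrix (a × b) (a × b) ℂ}
    {Y : Matrix (a' × b) (a' × b) ℂ} (hX : X ∈ unitaryGroup (a × b) ℂ)
    (hY : Y ∈ unitaryGroup (a' × b) ℂ) :
    directSumA X Y ∈ unitaryGroup ((a ⊕ a') × b) ℂ :=
  submatrix_mem_unitaryGroup (fromBlocks_diagonal_mem_unitaryGroup hX hY) _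

theorem directSumA_list_prod (l : List ℕ) (G : ℕ → Matrix (a × b) (a × b) ℂ)
    (H : ℕ → Matrix (a' × b) (a' × b) ℂ) :
    directSumA (l.map G).prod (l.map H).prod =
      (l.map fun i => directSumA (G i) (H i)).prod := by
  induction l with
  | nil => exact directSumA_one
  | cons i l ih => simp only [List.map_cons, List.prod_cons, directSumA_mul, ih]

/-- Summing factor by factor preserves control from either side, since the summands share the `B`
labels; equal lengths make the factors match up. -/
theorem HasSandwichForm.directSumA {m : ℕ} {X : Matrix (a × b) (a × b) ℂ}
    {Y : Matrix (a' × b) (a' × b) ℂ} (hX : HasSandwichForm m X) (hY : HasSandwichForm m Y) :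
    HasSandwichForm m (directSumA X Y) := by
  obtain ⟨G, hG, rfl⟩ := hasSandwichForm_iff.1 hX
  obtain ⟨H, hH, rfl⟩ := hasSandwichForm_iff.1 hY
  refine hasSandwichForm_iff.2 ⟨fun i => _root_.directSumA (G i) (H i),
    fun i => ⟨fun hi => ?_, fun hi => ?_⟩, directSumA_list_prod _ _ _⟩
  · obtain ⟨h1, h2⟩ := controlledInBasisA_iff.1 ((hG i).1 hi)
    obtain ⟨h3, h4⟩ := controlledInBasisA_iff.1 ((hH i).1 hi)
    refine controlledInBasisA_iff.2 ⟨directSumA_mem_unitaryGroup h1 h3, ?_⟩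
    rintro ⟨x | x, k⟩ ⟨y | y, l⟩ hxy
    · exact h2 (x, k) (y, l) fun h => hxy (congrArg Sum.inl h)
    · rfl
    · rfl
    · exact h4 (x, k) (y, l) fun h => hxy (congrArg Sum.inr h)
  · obtain ⟨h1, h2⟩ := controlledInBasisB_iff.1 ((hG i).2 hi)
    obtain ⟨h3, h4⟩ := controlledInBasisB_iff.1 ((hH i).2 hi)
    refine controlledInBasisB_iff.2 ⟨directSumA_mem_unitaryGroup h1 h3, ?_⟩
    rintro ⟨x | x, k⟩ ⟨y | y, l⟩ hxy
    · exact h2 (x, k) (y, l) hxy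
    · rfl
    · rfl
    · exact h4 (x, k) (y, l) hxy

theorem hasSandwichForm_sum {m : ℕ} (hm : Odd m) (f : a ↪ a')
    (ha : ∀ U ∈ unitaryGroup (a × b) ℂ, HasSandwichForm m U)
    (ha' : ∀ U ∈ unitaryGroup (a' × b) ℂ, HasSandwichForm m U)
    {U : Matrix ((a ⊕ a') × b) ((a ⊕ a') × b) ℂ} (hU : U ∈ unitaryGroup ((a ⊕ a') × b) ℂ) :
    HasSandwichForm (2 * m + 1) U := by
  let e := Equiv.sumProdDistrib a a' b
  obtain ⟨A₀, hA₀, A₁, hA₁, B₀, hB₀, B₁, hB₁, M, hM, hMloc, h⟩ :=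
    -- Pairing by `f` on `A` and the identity on `B` makes the rotation preserve the `B` label.
    cosine_sine_decomposition (f.prodMap (Function.Embedding.refl b))
      (submatrix_mem_unitaryGroup hU e.symm)
  have hU' : U = directSumA A₀ A₁ * M.submatrix e e * directSumA B₀ B₁ := by
    rw [directSumA, directSumA, submatrix_mul_equiv, submatrix_mul_equiv, ← h]
    ext x y
    exact congrArg₂ U (e.symm_apply_apply x).symm (e.symm_apply_apply y).symm
  have hMB : ControlledInBasisB (M.submatrix e e) := by
    refine controlledInBasisB_iff.2 ⟨submatrix_mem_unitaryGroup hM e, ?_⟩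
    rintro ⟨x | x, k⟩ ⟨y | y, l⟩ hxy <;>
    · refine hMloc _ _ fun h => ?_
      have h' := congrArg Prod.snd h
      exact hxy h'
  rw [hU', show 2 * m + 1 = m + 1 + m by ring]
  exact ((ha _ hA₀).directSumA (ha' _ hA₁)).mul_mul hm hMB ((ha _ hB₀).directSumA (ha' _ hB₁))

theorem hasSandwichForm_fin_add {m p q : ℕ} (hm : Odd m) (hpq : p ≤ q)
    (hp : ∀ U ∈ unitaryGroup (Fin p × b) ℂ, HasSandwichForm m U)
    (hq : ∀ U ∈ unitaryGroup (Fin q × b) ℂ, HasSandwichForm m U)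
    {U : Matrix (Fin (p + q) × b) (Fin (p + q) × b) ℂ}
    (hU : U ∈ unitaryGroup (Fin (p + q) × b) ℂ) :
    HasSandwichForm (2 * m + 1) U := by
  have h := (hasSandwichForm_sum hm (Fin.castLEEmb hpq) hp hq (submatrix_mem_unitaryGroup hU
    (finSumFinEquiv.prodCongr (Equiv.refl b)))).reindex finSumFinEquiv.symm
  rw [submatrix_submatrix] at h
  convert h using 1
  ext x y
  simp [Prod.map]

theorem hasSandwichForm_one_of_subsingleton [Subsingleton a] {U : Matrix (a × b) (a × b) ℂ}
    (hU : U ∈ unitaryGroup (a × b) ℂ) : HasSandwichForm 1 U :=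
  ⟨fun _ => U, fun i => ⟨fun _ => controlledInBasisA_iff.2
    ⟨hU, fun x y h => absurd (Subsingleton.elim _ _) h⟩,
    fun hi => by
      have : (i : ℕ) = 0 := by omega
      rw [this] at hi
      exact absurd hi (by decide)⟩, by simp⟩

/-- Allowing every d ≤ 2^n gives the floor and ceiling halves of d forms of a common length. -/
theorem hasSandwichForm_of_le_two_pow {n d : ℕ} (hd : d ≤ 2 ^ n)
    {U : Matrix (Fin d × b) (Fin d × b) ℂ} (hU : U ∈ unitaryGroup (Fin d × b) ℂ) :
    HasSandwichForm (2 ^ (n + 1) - 1) U := by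
  induction n generalizing d with
  | zero =>
    have : Subsingleton (Fin d) := Fin.subsingleton_iff_le_one.2 hd
    exact hasSandwichForm_one_of_subsingleton hU
  | succ n ih =>
    obtain ⟨p, q, hpq, hq, rfl⟩ : ∃ p q, p ≤ q ∧ q ≤ 2 ^ n ∧ d = p + q :=
      ⟨d / 2, d - d / 2, by omega, by omega, by omega⟩
    have hodd : Odd (2 ^ (n + 1) - 1) := Nat.Even.sub_odd Nat.one_le_two_pow
      (even_two.pow_of_ne_zero (by omega)) odd_one
    have h := hasSandwichForm_fin_add hodd hpq (fun V hV => ih (hpq.trans hq) hV)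
      (fun V hV => ih hq hV) hU
    convert h using 1
    have := Nat.one_le_two_pow (n := n)
    omega

theorem LocallyEquivalent.refl (U : Matrix (a × b) (a × b) ℂ) : LocallyEquivalent U U :=
  ⟨1, one_mem _, 1, one_mem _, 1, one_mem _, 1, one_mem _, by simp⟩

theorem HasSandwichForm.bipartiteDepth_le {m : ℕ} (hm : 1 ≤ m) {U : Matrix (a × b) (a × b) ℂ}
    (h : HasSandwichForm m U) : bipartiteDepth U ≤ (m : ℕ∞) := by
  obtain ⟨G, hG, hU⟩ := h
  refine iInf₂_le m ⟨hm, G, fun i => ⟨G i, ?_, LocallyEquivalent.refl _⟩, hU⟩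
  exact (Nat.even_or_odd ((i : ℕ) + 1)).symm.imp (hG i).1 (hG i).2

theorem hasSandwichForm_of_odd
    (hodd : ∀ d : ℕ, Odd d → 3 ≤ d → ∀ U ∈ unitaryGroup (Fin d × b) ℂ,
      HasSandwichForm (2 * d - 1) U)
    {d : ℕ} (hd : 1 ≤ d) {U : Matrix (Fin d × b) (Fin d × b) ℂ}
    (hU : U ∈ unitaryGroup (Fin d × b) ℂ) : HasSandwichForm (2 * d - 1) U := by
  induction d using Nat.strong_induction_on with
  | _ d ih =>
    rcases Nat.even_or_odd d with ⟨p, rfl⟩ | ho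
    · have h := hasSandwichForm_fin_add (m := 2 * p - 1) ⟨p - 1, by omega⟩ le_rfl
        (fun V hV => ih p (by omega) (by omega) hV) (fun V hV => ih p (by omega) (by omega) hV) hU
      convert h using 1
      omega
    · rcases Nat.lt_or_ge d 3 with h3 | h3
      · obtain rfl : d = 1 := by
          obtain ⟨k, rfl⟩ := ho
          omega
        exact hasSandwichForm_one_of_subsingleton hU
      · exact hodd d ho h3 U hU

end Sandwich

theorem natCeil_logb_two (d : ℕ) : ⌈Real.logb 2 (d : ℝ)⌉₊ = Nat.clog 2 d :=
  Real.natCeil_logb_natCast 2 d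

theorem theorem1 (dB : ℕ) (hB : 1 ≤ dB) :
    (∀ dA : ℕ, 1 ≤ dA →
      ∀ U : Matrix (Fin dA × Fin dB) (Fin dA × Fin dB) ℂ,
        U ∈ Matrix.unitaryGroup (Fin dA × Fin dB) ℂ →
        HasSandwichForm (2 ^ (⌈Real.logb 2 (dA : ℝ)⌉₊ + 1) - 1) U ∧
        (2 ≤ dA →
          bipartiteDepth U ≤ ((2 ^ (⌈Real.logb 2 (dA : ℝ)⌉₊ + 1) - 1 : ℕ) : ℕ∞) ∧
          2 ^ (⌈Real.logb 2 (dA : ℝ)⌉₊ + 1) - 1 ≤ 4 * dA - 5 ∧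
          bipartiteDepth U ≤ ((4 * dA - 5 : ℕ) : ℕ∞)) ∧
        ((∃ n : ℕ, dA = 2 ^ n) → bipartiteDepth U ≤ ((2 * dA - 1 : ℕ) : ℕ∞))) ∧
    ((∀ dA : ℕ, Odd dA → 3 ≤ dA →
        ∀ U : Matrix (Fin dA × Fin dB) (Fin dA × Fin dB) ℂ,
          U ∈ Matrix.unitaryGroup (Fin dA × Fin dB) ℂ → HasSandwichForm (2 * dA - 1) U) →
      ∀ dA : ℕ, Even dA → 2 ≤ dA →
        ∀ U : Matrix (Fin dA × Fin dB) (Fin dA × Fin dB) ℂ,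
          U ∈ Matrix.unitaryGroup (Fin dA × Fin dB) ℂ → HasSandwichForm (2 * dA - 1) U) := by
  refine ⟨fun dA hA U hU => ?_, fun hodd dA _ h2 U hU =>
    hasSandwichForm_of_odd hodd (one_le_two.trans h2) hU⟩
  rw [natCeil_logb_two]
  have hform : HasSandwichForm (2 ^ (Nat.clog 2 dA + 1) - 1) U :=
    hasSandwichForm_of_le_two_pow (Nat.le_pow_clog one_lt_two dA) hU
  have hpos : 1 ≤ 2 ^ (Nat.clog 2 dA + 1) - 1 := by
    have := Nat.one_le_two_pow (n := Nat.clog 2 dA)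
    omega
  have hdepth := hform.bipartiteDepth_le hpos
  refine ⟨hform, fun h2 => ?_, ?_⟩
  · have hle : 2 ^ (Nat.clog 2 dA + 1) - 1 ≤ 4 * dA - 5 := by
      -- With c = `Nat.clog 2 dA`, 2^(c-1) ≤ dA - 1, so 2^(c+1) - 1 ≤ 4(dA - 1) - 1.
      have h1 := Nat.pow_pred_clog_lt_self one_lt_two (show 1 < dA from h2)
      obtain ⟨k, hk⟩ := Nat.exists_eq_succ_of_ne_zero (Nat.clog_pos one_lt_two h2).ne'
      rw [hk] at h1 ⊢
      simp only [Nat.succ_eq_add_one, Nat.pred_succ, pow_succ] at h1 ⊢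
      omega
    exact ⟨hdepth, hle, hdepth.trans (by exact_mod_cast hle)⟩
  · rintro ⟨n, rfl⟩
    rw [Nat.clog_pow 2 n one_lt_two, pow_succ, mul_comm] at hdepth
    exact hdepth
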